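/- **Theorem 4.8.** Let $(M,g)$ be a compact connected smooth Riemannian manifold (without boundary) and let $\mathcal E\to M$ be a smooth real vector bundle of finite rank with a smooth fibre metric $\langle\,,\rangle$ and a smooth connection $\nabla$ compatible with it. For $p,q\in\mathbb R$ define the vertical $(p,q)$-energy of a smooth section $\sigma$ of $\mathcal E$ by $$E^v_{p,q}(\sigma)=\frac12\int_M \frac{1}{(1+|\sigma|^2)^{p}}\sum_i\Bigl(\langle\nabla_{E_i}\sigma,\nabla_{E_i}\sigma\rangle+q\,\langle\nabla_{E_i}\sigma,\sigma\rangle^2\Bigr)\operatorname{vol}(g),$$ where $\{E_i\}$ is a local orthonormal tangent frame of $M$. Call $\sigma$ *$(p,q)$-harmonic* if $\left.\frac{d}{dt}\right|_{t=0}E^v_{p,q}(\sigma_t)=0$ for every smooth variation $\sigma_t$ $(t\in\mathbb R)$ of $\sigma_0=\sigma$ through sections of $\mathcal E$. Suppose $\sigma$ is a smooth section of $\mathcal E$ whose length $|\sigma|$ is not constant on $M$. Then for each $p\in\mathbb R$ there exists at most one $q\in\mathbb R$ such that $\sigma$ is $(p,q)$-harmonic. -/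

import Mathlib

open Bundle Manifold MeasureTheory
open scoped ContDiff

noncomputable section

section Volume

variable {n : ℕ} {M : Type*} [TopologicalSpace M] [ChartedSpace (EuclideanSpace ℝ (Fin n)) M]
  [RiemannianBundle (fun x : M ↦ TangentSpace (𝓡 n) x)]

/-- The coordinate vector field `∂ᵢ` of the chart centred at `c`, as a tangent vector at the point
of `M` with coordinates `y`: the image of the `i`-th standard basis vector under the differential
of the inverse chart. -/
def coordVector (c : M) (y : EuclideanSpace ℝ (Fin n)) (i : Fin n) :
    TangentSpace (𝓡 n) ((chartAt (EuclideanSpace ℝ (Fin n)) c).symm y) :=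
  mfderiv (𝓡 n) (𝓡 n) (chartAt (EuclideanSpace ℝ (Fin n)) c).symm y (EuclideanSpace.single i 1)

/-- The Gram matrix `gᵢⱼ = g(∂ᵢ, ∂ⱼ)` of the Riemannian metric in the chart centred at `c`, at the
point with coordinates `y`. -/
def metricMatrix (c : M) (y : EuclideanSpace ℝ (Fin n)) : Matrix (Fin n) (Fin n) ℝ :=
  Matrix.of fun i j ↦ inner ℝ (coordVector c y i) (coordVector c y j)

variable [MeasurableSpace M]

/-- The Riemannian measure on the domain of the chart centred at `c`, extended by zero to `M`:
in coordinates it is `√(det gᵢⱼ) dy` on the target of the chart. -/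
def chartVolume (c : M) : Measure M :=
  (((volume : Measure (EuclideanSpace ℝ (Fin n))).restrict
      (chartAt (EuclideanSpace ℝ (Fin n)) c).target).withDensity
    (fun y ↦ ENNReal.ofReal (Real.sqrt (metricMatrix c y).det))).map
    (chartAt (EuclideanSpace ℝ (Fin n)) c).symm

variable (n M) in
/-- A smooth partition of unity on `M`, indexed by the points of `M`, in which the function with
index `c` is supported in the domain of the chart centred at `c`. -/
def chartPartition [IsManifold (𝓡 n) ∞ M] [T2Space M] [SigmaCompactSpace M] :
    SmoothPartitionOfUnity M (𝓡 n) M Set.univ :=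
  (SmoothPartitionOfUnity.exists_isSubordinate_chartAt_source (𝓡 n) M).choose

variable (n M) in
/-- The Riemannian measure `vol(g)` of `M`, glued from the measures `√(det gᵢⱼ) dy` of the charts
by a partition of unity. By the change of variables formula the measures of two charts agree on
the intersection of their domains, so the result does not depend on the partition. No orientation
is used. -/
def riemannianVolume [IsManifold (𝓡 n) ∞ M] [T2Space M] [SigmaCompactSpace M] : Measure M :=
  Measure.sum fun c : M ↦
    (chartVolume (n := n) c).withDensity fun x ↦ ENNReal.ofReal (chartPartition n M c x)

end Volume

/-- The restriction of `h_{p,q}` to vertical vectors. The vertical space at `e` is identified with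
the fibre `W` through `e` (by the connection map), and
`h_{p,q}(u, v) = (1 + |e|²)⁻ᵖ (⟨u, v⟩ + q ⟨u, e⟩ ⟨v, e⟩)`. -/
def verticalForm {W : Type*} [NormedAddCommGroup W] [InnerProductSpace ℝ W]
    (p q : ℝ) (e u v : W) : ℝ :=
  (1 / (1 + ‖e‖ ^ 2)) ^ p * (inner ℝ u v + q * inner ℝ u e * inner ℝ v e)

instance tangentSpaceFiniteDimensional {n : ℕ} {M : Type*} [TopologicalSpace M]
    [ChartedSpace (EuclideanSpace ℝ (Fin n)) M] (x : M) :
    FiniteDimensional ℝ (TangentSpace (𝓡 n) x) :=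
  inferInstanceAs (FiniteDimensional ℝ (EuclideanSpace ℝ (Fin n)))

section Energy

variable {n : ℕ} {M : Type*} [TopologicalSpace M] [ChartedSpace (EuclideanSpace ℝ (Fin n)) M]
  [RiemannianBundle (fun x : M ↦ TangentSpace (𝓡 n) x)]
  {F : Type*} [NormedAddCommGroup F] [NormedSpace ℝ F]
  {V : M → Type*} [TopologicalSpace (TotalSpace F V)]
  [∀ x, NormedAddCommGroup (V x)] [∀ x, InnerProductSpace ℝ (V x)] [FiberBundle F V]

/-- The squared length at `x`, with respect to `h_{p,q}`, of the vertical differential `dᵛσ`, that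
is `∑ᵢ h_{p,q}(dᵛσ(Eᵢ), dᵛσ(Eᵢ))` for an orthonormal basis `Eᵢ` of the tangent space at `x`.
The vertical component of `dσ(X)` is `∇_X σ`, which is `cov σ x X` here. -/
def verticalNormSq (cov : CovariantDerivative (𝓡 n) F V) (p q : ℝ) (σ : Π x : M, V x) (x : M) :
    ℝ :=
  ∑ i, verticalForm p q (σ x)
    (cov σ x (stdOrthonormalBasis ℝ (TangentSpace (𝓡 n) x) i))
    (cov σ x (stdOrthonormalBasis ℝ (TangentSpace (𝓡 n) x) i))

variable [MeasurableSpace M] [IsManifold (𝓡 n) ∞ M] [T2Space M]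

/-- The vertical `(p,q)`-energy `½ ∫_M |dᵛσ|² vol(g)` of a section over a compact manifold. -/
def verticalEnergy [CompactSpace M] (cov : CovariantDerivative (𝓡 n) F V) (p q : ℝ)
    (σ : Π x : M, V x) : ℝ :=
  (1 / 2) * ∫ x, verticalNormSq cov p q σ x ∂(riemannianVolume n M)

/-- `s` is a smooth variation of `σ` through sections: `(x, t) ↦ s t x` is a smooth map from
`M × ℝ` to the total space, and `s 0 = σ`. -/
structure IsSmoothVariation (σ : Π x : M, V x) (s : ℝ → Π x : M, V x) : Prop where
  smooth : ContMDiff ((𝓡 n).prod 𝓘(ℝ, ℝ)) ((𝓡 n).prod 𝓘(ℝ, F)) ∞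
    (fun z : M × ℝ ↦ TotalSpace.mk' F z.1 (s z.2 z.1))
  initial : s 0 = σ

/-- `σ` is a `(p,q)`-harmonic section over a compact manifold: it is smooth and stationary for the vertical
`(p,q)`-energy with respect to all smooth variations through sections. -/
def IsPQHarmonic [CompactSpace M] (cov : CovariantDerivative (𝓡 n) F V) (p q : ℝ)
    (σ : Π x : M, V x) : Prop :=
  ContMDiff (𝓡 n) ((𝓡 n).prod 𝓘(ℝ, F)) ∞ (fun x ↦ TotalSpace.mk' F x (σ x)) ∧
    ∀ s : ℝ → Π x : M, V x, IsSmoothVariation (n := n) (F := F) σ s →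
      HasDerivAt (fun t ↦ verticalEnergy cov p q (s t)) 0 0

end Energy

end

/-! The `(p,q)`-energy is affine in `q`, with slope the radial energy `½ ∫ (1 + |σ|²)⁻ᵖ |⟨∇σ, σ⟩|²`.
A section harmonic for two values of `q` is therefore stationary for the radial energy alone
(`verticalEnergy_sub`).

Such a section is tested on `(1 + t a) σ`, where `a` is a function of `u = |σ|²` with derivative
`b`. By metric compatibility `⟨∇σ, σ⟩` is half of `d|σ|²`, so along this variation it is only
multiplied by a scalar (`inner_cov_comp_smul`). The derivative of the energy density at `t = 0`, up
to the factor `½`, is `(1 + u)⁻ᵖ (4a + 4bu - 2pau / (1 + u)) |⟨∇σ, σ⟩|²`. For `a = (1 + u)^(p/2)`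
the last two terms cancel and the coefficient is positive. Stationarity thus forces `⟨∇σ, σ⟩ = 0`
(`radialNormSq_eq_zero_of_hasDerivAt`), so `|σ|²` has zero differential and is constant on the
connected manifold.

The analysis requires that the Riemannian measure is finite and charges open sets, and that the
energy densities are continuous. -/

/-! ### The Riemannian measure is finite and positive on open sets -/

section RiemannianVolume

variable {n : ℕ} {M : Type*} [TopologicalSpace M] [ChartedSpace (EuclideanSpace ℝ (Fin n)) M]

theorem coordVector_linearIndependent [IsManifold (𝓡 n) ∞ M] (c : M)
    {y : EuclideanSpace ℝ (Fin n)} (hy : y ∈ (chartAt (EuclideanSpace ℝ (Fin n)) c).target) :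
    LinearIndependent ℝ (coordVector c y) := by
  have : IsManifold (𝓡 n) 1 M := IsManifold.of_le (n := ∞) (by norm_num)
  have hinj := ((mdifferentiable_chart (I := 𝓡 n) c).symm).mfderiv_injective hy
  have hb : LinearIndependent ℝ
      (fun i : Fin n ↦ (EuclideanSpace.single i (1 : ℝ) : EuclideanSpace ℝ (Fin n))) := by
    have h := (EuclideanSpace.basisFun (Fin n) ℝ).orthonormal.linearIndependent
    have h2 : ⇑(EuclideanSpace.basisFun (Fin n) ℝ) = fun i ↦ EuclideanSpace.single i (1 : ℝ) :=
      funext fun i ↦ EuclideanSpace.basisFun_apply _ _ i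
    rwa [h2] at h
  exact hb.map' _ (LinearMap.ker_eq_bot.2 hinj)

variable [RiemannianBundle (fun x : M ↦ TangentSpace (𝓡 n) x)]

theorem metricMatrix_det_pos [IsManifold (𝓡 n) ∞ M] (c : M)
    {y : EuclideanSpace ℝ (Fin n)} (hy : y ∈ (chartAt (EuclideanSpace ℝ (Fin n)) c).target) :
    0 < (metricMatrix c y).det := by
  have h : metricMatrix c y = Matrix.gram ℝ (coordVector c y) := rfl
  rw [h]
  have h2 := coordVector_linearIndependent c hy
  have h3 : Matrix.PosDef (Matrix.gram ℝ (coordVector c y)) := by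
    apply Matrix.posDef_gram_of_linearIndependent
    rw [Fintype.linearIndependent_iff] at h2 ⊢
    exact h2
  exact h3.det_pos

/-- The coordinate fields are images of constant fields under the tangent map of the inverse chart,
hence continuous, and the metric is continuous. -/
theorem continuousOn_metricMatrix_det [IsManifold (𝓡 n) ∞ M]
    [IsContMDiffRiemannianBundle (𝓡 n) ∞ (EuclideanSpace ℝ (Fin n))
      (fun x : M ↦ TangentSpace (𝓡 n) x)] (c : M) :
    ContinuousOn (fun y ↦ (metricMatrix c y).det)
      (chartAt (EuclideanSpace ℝ (Fin n)) c).target := by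
  have : IsContinuousRiemannianBundle (EuclideanSpace ℝ (Fin n))
      (fun x : M ↦ TangentSpace (𝓡 n) x) := by
    have := IsContMDiffRiemannianBundle.exists_contMDiff (IB := 𝓡 n) (n := ∞)
      (F := EuclideanSpace ℝ (Fin n)) (E := fun x : M ↦ TangentSpace (𝓡 n) x)
    obtain ⟨g, hg, h⟩ := this
    exact ⟨g, hg.continuous, h⟩
  set e := chartAt (EuclideanSpace ℝ (Fin n)) c
  have hs : ContMDiffOn (𝓡 n) (𝓡 n) ∞ e.symm e.target := contMDiffOn_chart_symm
  have h1 := hs.continuousOn_tangentMapWithin (by norm_num) e.open_target.uniqueMDiffOn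
  have h2 (i : Fin n) : ContinuousOn (fun y ↦ (⟨e.symm y, coordVector c y i⟩ :
      TangentBundle (𝓡 n) M)) e.target := by
    have h3 : Continuous (fun y : EuclideanSpace ℝ (Fin n) ↦
        (⟨y, EuclideanSpace.single i (1 : ℝ)⟩ :
          TangentBundle (𝓡 n) (EuclideanSpace ℝ (Fin n)))) := by
      have h4 : Continuous (fun y : EuclideanSpace ℝ (Fin n) ↦
        (tangentBundleModelSpaceHomeomorph (𝓡 n)).symm
          (y, (EuclideanSpace.single i (1 : ℝ) : EuclideanSpace ℝ (Fin n)))) :=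
        (Homeomorph.continuous _).comp (by fun_prop)
      exact h4
    refine (h1.comp h3.continuousOn fun y hy ↦ hy).congr fun y hy ↦ ?_
    simp only [Function.comp, tangentMapWithin, mfderivWithin_of_isOpen e.open_target hy]
    rfl
  have h5 : ContinuousOn (fun y ↦ metricMatrix c y) e.target := by
    refine continuousOn_pi.2 fun i ↦ continuousOn_pi.2 fun j ↦ ?_
    exact (h2 i).inner_bundle (F := EuclideanSpace ℝ (Fin n)) (h2 j)
  exact (Continuous.matrix_det continuous_id).comp_continuousOn h5

variable [MeasurableSpace M] [BorelSpace M]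

theorem chartVolume_apply (c : M) {s : Set M} (hs : MeasurableSet s) :
    chartVolume (n := n) c s = ∫⁻ y in (chartAt (EuclideanSpace ℝ (Fin n)) c).target ∩
      (chartAt (EuclideanSpace ℝ (Fin n)) c).symm ⁻¹' s,
      ENNReal.ofReal (Real.sqrt (metricMatrix c y).det) := by
  set e := chartAt (EuclideanSpace ℝ (Fin n)) c
  have h1 : AEMeasurable e.symm (volume.restrict e.target) :=
    ContinuousOn.aemeasurable e.continuousOn_symm e.open_target.measurableSet
  have h2 : NullMeasurableSet (e.symm ⁻¹' s) (volume.restrict e.target) :=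
    h1.nullMeasurable hs
  rw [chartVolume, Measure.map_apply_of_aemeasurable
    (h1.mono_ac (withDensity_absolutelyContinuous _ _)) hs, withDensity_apply₀ _ h2,
    Measure.restrict_restrict₀ h2, Set.inter_comm]

variable [IsManifold (𝓡 n) ∞ M] [IsContMDiffRiemannianBundle (𝓡 n) ∞ (EuclideanSpace ℝ (Fin n))
  (fun x : M ↦ TangentSpace (𝓡 n) x)]

theorem chartVolume_lt_top_of_isCompact [T2Space M] (c : M) {K : Set M} (hK : IsCompact K)
    (hKc : K ⊆ (chartAt (EuclideanSpace ℝ (Fin n)) c).source) : chartVolume (n := n) c K < ⊤ := by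
  rw [chartVolume_apply c hK.measurableSet]
  set e := chartAt (EuclideanSpace ℝ (Fin n)) c
  have h1 : e.target ∩ e.symm ⁻¹' K = e '' K := (e.image_eq_target_inter_inv_preimage hKc).symm
  rw [h1]
  have h2 : IsCompact (e '' K) := hK.image_of_continuousOn (e.continuousOn.mono hKc)
  have h3 : e '' K ⊆ e.target := by
    rw [← h1]
    exact Set.inter_subset_left
  have h4 : ContinuousOn (fun y ↦ Real.sqrt (metricMatrix c y).det) (e '' K) :=
    ((continuousOn_metricMatrix_det c).mono h3).sqrt
  exact (h4.integrableOn_compact h2).lintegral_lt_top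

/-- The density is strictly positive on the chart target, so measure zero would make a nonempty open
set of coordinates Lebesgue null. -/
theorem chartVolume_pos_of_isOpen (c : M) {U : Set M} (hU : IsOpen U)
    (hUc : (U ∩ (chartAt (EuclideanSpace ℝ (Fin n)) c).source).Nonempty) :
    0 < chartVolume (n := n) c U := by
  rw [chartVolume_apply c hU.measurableSet]
  set e := chartAt (EuclideanSpace ℝ (Fin n)) c
  have h1 : IsOpen (e.target ∩ e.symm ⁻¹' U) := e.isOpen_inter_preimage_symm hU
  obtain ⟨x, hxU, hx⟩ := hUc
  have h2 : (e.target ∩ e.symm ⁻¹' U).Nonempty :=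
    ⟨e x, e.map_source hx, by simpa [e.left_inv hx] using hxU⟩
  have h3 : AEMeasurable (fun y ↦ ENNReal.ofReal (Real.sqrt (metricMatrix c y).det))
      (volume.restrict (e.target ∩ e.symm ⁻¹' U)) := by
    refine ENNReal.measurable_ofReal.comp_aemeasurable ?_
    exact ((continuousOn_metricMatrix_det c).mono Set.inter_subset_left).sqrt.aemeasurable
      h1.measurableSet
  rw [pos_iff_ne_zero, Ne, lintegral_eq_zero_iff' h3]
  intro h4
  rw [Filter.EventuallyEq, ae_restrict_iff' h1.measurableSet] at h4
  have h5 : volume (e.target ∩ e.symm ⁻¹' U) = 0 := by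
    refine measure_mono_null (fun y hy ↦ ?_) h4
    simp only [Set.mem_compl_iff, Set.mem_ofPred_eq, not_forall]
    refine ⟨hy, ?_⟩
    simpa using metricMatrix_det_pos c hy.1
  exact (h1.measure_pos volume h2).ne' h5

variable (n M) in
-- By compactness only finitely many functions of the partition are nonzero, and each contributes at
-- most the chart volume of its compact support.
theorem isFiniteMeasure_riemannianVolume [T2Space M] [CompactSpace M] :
    IsFiniteMeasure (riemannianVolume n M) := by
  constructor
  set ρ := chartPartition n M
  have hρ : ρ.IsSubordinate fun c ↦ (chartAt (EuclideanSpace ℝ (Fin n)) c).source :=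
    (SmoothPartitionOfUnity.exists_isSubordinate_chartAt_source (𝓡 n) M).choose_spec
  have hfin := ρ.locallyFinite.finite_nonempty_of_compact
  have hterm (c : M) : (chartVolume (n := n) c).withDensity
      (fun x ↦ ENNReal.ofReal (ρ c x)) Set.univ ≤ chartVolume (n := n) c (tsupport (ρ c)) := by
    rw [withDensity_apply _ MeasurableSet.univ, Measure.restrict_univ,
      ← lintegral_indicator_one (isClosed_tsupport (ρ c)).measurableSet]
    refine lintegral_mono fun x ↦ ?_
    by_cases hx : x ∈ tsupport (ρ c)
    · simpa [hx] using ρ.le_one c x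
    · simp [image_eq_zero_of_notMem_tsupport hx]
  rw [riemannianVolume, Measure.sum_apply _ MeasurableSet.univ,
    tsum_eq_sum (s := hfin.toFinset) fun c hc ↦ ?_]
  · refine ENNReal.sum_lt_top.2 fun c _ ↦ (hterm c).trans_lt ?_
    exact chartVolume_lt_top_of_isCompact c (isClosed_tsupport _).isCompact (hρ c)
  · have h0 : (fun x ↦ ENNReal.ofReal (ρ c x)) = 0 := by
      funext x
      have h1 : x ∉ Function.support (ρ c) := fun hx ↦
        hc (hfin.mem_toFinset.2 ⟨x, hx⟩)
      simpa using (Function.notMem_support.1 h1).le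
    change (chartVolume (n := n) c).withDensity (fun x ↦ ENNReal.ofReal (ρ c x)) _ = 0
    rw [h0, withDensity_zero]
    simp

variable (n M) in
-- Around any point of `U` some partition function is positive, and already its chart gives `U`
-- positive mass.
theorem isOpenPosMeasure_riemannianVolume [T2Space M] [SigmaCompactSpace M] :
    (riemannianVolume n M).IsOpenPosMeasure := by
  constructor
  rintro U hU ⟨x, hx⟩
  set ρ := chartPartition n M
  have hρ : ρ.IsSubordinate fun c ↦ (chartAt (EuclideanSpace ℝ (Fin n)) c).source :=
    (SmoothPartitionOfUnity.exists_isSubordinate_chartAt_source (𝓡 n) M).choose_spec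
  obtain ⟨c, hc⟩ := ρ.exists_pos_of_mem (Set.mem_univ x)
  have hcont : Continuous (ρ c) := (ρ c).contMDiff.continuous
  have hW : IsOpen (U ∩ {z | 0 < ρ c z}) := hU.inter (isOpen_lt continuous_const hcont)
  have hpos : 0 < chartVolume (n := n) c (U ∩ {z | 0 < ρ c z}) :=
    chartVolume_pos_of_isOpen c hW ⟨x, ⟨hx, hc⟩, hρ c (subset_tsupport _ hc.ne')⟩
  intro h0
  have h1 : (chartVolume (n := n) c).withDensity (fun x ↦ ENNReal.ofReal (ρ c x)) U = 0 :=
    le_antisymm ((Measure.le_sum (fun c : M ↦ (chartVolume (n := n) c).withDensity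
      fun x ↦ ENNReal.ofReal (ρ c x)) c U).trans h0.le) bot_le
  rw [withDensity_apply_eq_zero (by fun_prop)] at h1
  refine hpos.ne' (measure_mono_null ?_ h1)
  exact fun z hz ↦ ⟨by simpa using hz.2, hz.1⟩

end RiemannianVolume

/-! ### Continuity of the energy density -/

section OrthonormalTrace

variable {W ι κ : Type*} [NormedAddCommGroup W] [InnerProductSpace ℝ W] [Fintype ι] [Fintype κ]
  [DecidableEq κ]

/-- The trace of a bilinear form over an orthonormal basis, in terms of an arbitrary basis. -/
theorem OrthonormalBasis.sum_apply_self_eq_sum_gram_inv (E : OrthonormalBasis ι ℝ W)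
    (b : Module.Basis κ ℝ W) (B : W →ₗ[ℝ] W →ₗ[ℝ] ℝ) :
    ∑ i, B (E i) (E i) = ∑ k, ∑ l, (Matrix.gram ℝ b)⁻¹ k l * B (b k) (b l) := by
  classical
  set P : Matrix ι κ ℝ := E.toBasis.toMatrix b with hP
  set Q : Matrix κ ι ℝ := b.toMatrix E.toBasis with hQ
  have hQP : Q * P = 1 := b.toMatrix_mul_toMatrix_flip E.toBasis
  have hPQ : P * Q = 1 := E.toBasis.toMatrix_mul_toMatrix_flip b
  -- Orthonormality of `E` factors the Gram matrix as `Pᵀ P`, so its inverse `Q Qᵀ` is the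
  -- coefficient matrix of the trace.
  have hgram : Matrix.gram ℝ b = P.transpose * P := by
    rw [Matrix.gram_eq_conjTranspose_mul E b]
    rfl
  have hinv : (Matrix.gram ℝ b)⁻¹ = Q * Q.transpose := by
    refine Matrix.inv_eq_right_inv ?_
    rw [hgram, Matrix.mul_assoc, ← Matrix.mul_assoc P, hPQ, Matrix.one_mul,
      ← Matrix.transpose_mul, hQP, Matrix.transpose_one]
  have hE (i : ι) : E i = ∑ k, Q k i • b k := by
    have h := b.sum_toMatrix_smul_self E.toBasis i
    rw [E.coe_toBasis] at h
    exact h.symm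
  have hB (i : ι) : B (E i) (E i) = ∑ k, ∑ l, Q k i * Q l i * B (b k) (b l) := by
    conv_lhs => rw [hE i]
    simp only [map_sum, LinearMap.sum_apply, map_smul, LinearMap.smul_apply, smul_eq_mul,
      Finset.mul_sum]
    rw [Finset.sum_comm]
    refine Finset.sum_congr rfl fun k _ ↦ Finset.sum_congr rfl fun l _ ↦ by ring
  simp only [hB, hinv, Matrix.mul_apply, Matrix.transpose_apply, Finset.sum_mul]
  rw [Finset.sum_comm]
  refine Finset.sum_congr rfl fun k _ ↦ ?_
  rw [Finset.sum_comm]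

end OrthonormalTrace

/-- The pullback of the form `verticalForm p q e` under a linear map, as a bilinear map. -/
noncomputable def verticalBilin {U W : Type*} [AddCommGroup U] [Module ℝ U] [NormedAddCommGroup W]
    [InnerProductSpace ℝ W] (p q : ℝ) (e : W) (A : U →ₗ[ℝ] W) : U →ₗ[ℝ] U →ₗ[ℝ] ℝ :=
  LinearMap.mk₂ ℝ (fun u v ↦ verticalForm p q e (A u) (A v))
    (fun u v w ↦ by simp only [verticalForm, map_add, inner_add_left]; ring)
    (fun a u v ↦ by simp only [verticalForm, map_smul, real_inner_smul_left, smul_eq_mul]; ring)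
    (fun u v w ↦ by
      simp only [verticalForm, map_add, inner_add_left, inner_add_right]; ring)
    (fun a u v ↦ by
      simp only [verticalForm, map_smul, real_inner_smul_left, real_inner_smul_right,
        smul_eq_mul]; ring)

section NormSq

variable {n : ℕ} {M : Type*} [TopologicalSpace M]
  [ChartedSpace (EuclideanSpace ℝ (Fin n)) M] [IsManifold (𝓡 n) ∞ M]
  [RiemannianBundle (fun x : M ↦ TangentSpace (𝓡 n) x)]
  [IsContMDiffRiemannianBundle (𝓡 n) ∞ (EuclideanSpace ℝ (Fin n))
    (fun x : M ↦ TangentSpace (𝓡 n) x)]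
  {F : Type*} [NormedAddCommGroup F] [NormedSpace ℝ F]
  {V : M → Type*} [TopologicalSpace (TotalSpace F V)]
  [∀ x, NormedAddCommGroup (V x)] [∀ x, InnerProductSpace ℝ (V x)]
  [FiberBundle F V] [VectorBundle ℝ F V]
  [IsContMDiffRiemannianBundle (𝓡 n) ∞ F V]

/-- The orthonormal bases are chosen point by point, with no continuity in `x`. The trace does not
depend on them: near `x₀` it is computed in a smooth local frame, weighted by the inverse Gram
matrix. -/
theorem continuous_verticalNormSq (cov : CovariantDerivative (𝓡 n) F V)
    [hc : cov.ContMDiffCovariantDerivative ∞] (p q : ℝ) {σ : Π x : M, V x}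
    (hσ : ContMDiff (𝓡 n) ((𝓡 n).prod 𝓘(ℝ, F)) ∞ (fun x ↦ TotalSpace.mk' F x (σ x))) :
    Continuous (verticalNormSq cov p q σ) := by
  rw [continuous_iff_continuousAt]
  intro x₀
  set e := trivializationAt (EuclideanSpace ℝ (Fin n)) (TangentSpace (𝓡 n) : M → Type _) x₀
  set b₀ := (EuclideanSpace.basisFun (Fin n) ℝ).toBasis
  set s := e.localFrame b₀
  have hx₀ : x₀ ∈ e.baseSet := FiberBundle.mem_baseSet_trivializationAt' x₀
  have hs := e.isLocalFrameOn_localFrame_baseSet (𝓡 n) ∞ b₀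
  have hsx (i : Fin n) : ContMDiffAt (𝓡 n) ((𝓡 n).prod 𝓘(ℝ, EuclideanSpace ℝ (Fin n))) ∞
      (fun x ↦ TotalSpace.mk' (EuclideanSpace ℝ (Fin n)) x (s i x)) x₀ :=
    hs.contMDiffAt e.open_baseSet hx₀ i
  have hcovσ : ContMDiff (𝓡 n) ((𝓡 n).prod 𝓘(ℝ, EuclideanSpace ℝ (Fin n) →L[ℝ] F)) ∞
      (fun x ↦ TotalSpace.mk' (EuclideanSpace ℝ (Fin n) →L[ℝ] F)
        (E := fun x : M ↦ TangentSpace (𝓡 n) x →L[ℝ] V x) x (cov σ x)) := by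
    rw [← contMDiffOn_univ]
    exact hc.contMDiff.contMDiff hσ.contMDiffOn
  have hcs (i : Fin n) : ContMDiffAt (𝓡 n) ((𝓡 n).prod 𝓘(ℝ, F)) ∞
      (fun x ↦ TotalSpace.mk' F x (cov σ x (s i x))) x₀ :=
    (hcovσ x₀).clm_bundle_apply (hsx i)
  have hgram : ContinuousAt (fun x ↦ Matrix.gram ℝ (fun i ↦ s i x)) x₀ :=
    continuousAt_pi.2 fun i ↦ continuousAt_pi.2 fun j ↦
      ((hsx i).inner_bundle (hsx j)).continuousAt
  have hform (i j : Fin n) : ContinuousAt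
      (fun x ↦ verticalForm p q (σ x) (cov σ x (s i x)) (cov σ x (s j x))) x₀ := by
    have h1 := ((hσ x₀).inner_bundle (hσ x₀)).continuousAt
    have h2 := ((hcs i).inner_bundle (hcs j)).continuousAt
    have h3 := ((hcs i).inner_bundle (hσ x₀)).continuousAt
    have h4 := ((hcs j).inner_bundle (hσ x₀)).continuousAt
    simp only [real_inner_self_eq_norm_sq] at h1
    have h0 : 0 < 1 + ‖σ x₀‖ ^ 2 := by positivity
    have h5 : ContinuousAt (fun x ↦ (1 / (1 + ‖σ x‖ ^ 2)) ^ p) x₀ :=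
      (continuousAt_const.div (continuousAt_const.add h1) h0.ne').rpow_const
        (Or.inl (one_div_pos.2 h0).ne')
    exact h5.mul (h2.add ((continuousAt_const.mul h3).mul h4))
  have hdet : (Matrix.gram ℝ (fun i ↦ s i x₀)).det ≠ 0 := by
    have h := hs.linearIndependent hx₀
    rw [Matrix.det_gram_ne_zero_iff_linearIndependent]
    rw [Fintype.linearIndependent_iff] at h ⊢
    exact h
  have hmain : ContinuousAt (fun x ↦ ∑ k, ∑ l, (Matrix.gram ℝ (fun i ↦ s i x))⁻¹ k l *
      verticalForm p q (σ x) (cov σ x (s k x)) (cov σ x (s l x))) x₀ := by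
    have hinv : ContinuousAt (fun x ↦ (Matrix.gram ℝ (fun i ↦ s i x))⁻¹) x₀ := by
      refine ContinuousAt.comp (g := Inv.inv) (continuousAt_matrix_inv _ ?_) hgram
      rw [Ring.inverse_eq_inv']
      exact continuousAt_inv₀ hdet
    refine tendsto_finsetSum _ fun k _ ↦ tendsto_finsetSum _ fun l _ ↦ ?_
    exact (continuousAt_pi.1 (continuousAt_pi.1 hinv k) l).mul (hform k l)
  refine hmain.congr ?_
  filter_upwards [e.open_baseSet.mem_nhds hx₀] with x hx
  have hE := (stdOrthonormalBasis ℝ (TangentSpace (𝓡 n) x)).sum_apply_self_eq_sum_gram_inv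
    (hs.toBasisAt hx) (verticalBilin p q (σ x) (cov σ x).toLinearMap)
  have hb : (hs.toBasisAt hx : Fin n → TangentSpace (𝓡 n) x) = fun i ↦ s i x :=
    funext fun i ↦ hs.toBasisAt_coe hx i
  rw [hb] at hE
  exact hE.symm

end NormSq

/-! ### Calculus lemmas -/

theorem hasDerivAt_integral_of_continuous_deriv {X : Type*} [TopologicalSpace X] [CompactSpace X]
    [MeasurableSpace X] [OpensMeasurableSpace X] (μ : Measure X) [IsFiniteMeasure μ]
    {f f' : ℝ → X → ℝ} (hf : ∀ t, Continuous (f t))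
    (hf' : Continuous fun z : ℝ × X ↦ f' z.1 z.2)
    (h : ∀ t x, HasDerivAt (fun s ↦ f s x) (f' t x) t) (t₀ : ℝ) :
    HasDerivAt (fun t ↦ ∫ x, f t x ∂μ) (∫ x, f' t₀ x ∂μ) t₀ := by
  have hK : IsCompact (Metric.closedBall t₀ 1 ×ˢ (Set.univ : Set X)) :=
    (isCompact_closedBall t₀ 1).prod isCompact_univ
  obtain ⟨C, hC⟩ := hK.exists_bound_of_continuousOn hf'.continuousOn
  refine (hasDerivAt_integral_of_dominated_loc_of_deriv_le (bound := fun _ ↦ C)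
    (Metric.closedBall_mem_nhds t₀ one_pos)
    (Filter.Eventually.of_forall fun t ↦ (hf t).aestronglyMeasurable)
    ((hf t₀).integrable_of_hasCompactSupport (HasCompactSupport.of_compactSpace _))
    (hf'.comp (Continuous.prodMk_right t₀)).aestronglyMeasurable
    (Filter.Eventually.of_forall fun x t ht ↦ hC (t, x) ⟨ht, Set.mem_univ x⟩)
    (integrable_const C)
    (Filter.Eventually.of_forall fun x t _ ↦ h t x)).2

/-- This is the factor multiplying `|⟨∇σ, σ⟩|²` in the radial energy density of `(1 + t a) σ`, with
`u = |σ|²`; in the application `b` is the derivative of `a` in `u`. -/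
theorem hasDerivAt_rpow_mul_sq {p u a b : ℝ} (hu : 0 ≤ u) (t : ℝ) :
    HasDerivAt (fun t ↦ (1 / (1 + (1 + t * a) ^ 2 * u)) ^ p *
        ((1 + t * a) ^ 2 + 2 * (1 + t * a) * (t * b) * u) ^ 2)
      ((2 * (1 + t * a) * a * u) * (-p) * (1 + (1 + t * a) ^ 2 * u) ^ (-p - 1) *
          ((1 + t * a) ^ 2 + 2 * (1 + t * a) * (t * b) * u) ^ 2 +
        (1 + (1 + t * a) ^ 2 * u) ^ (-p) *
          (2 * ((1 + t * a) ^ 2 + 2 * (1 + t * a) * (t * b) * u) *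
            (2 * (1 + t * a) * a + 2 * (a * (t * b) + (1 + t * a) * b) * u))) t := by
  have hpos (s : ℝ) : 0 < 1 + (1 + s * a) ^ 2 * u := by positivity
  have h0 : (fun t ↦ (1 / (1 + (1 + t * a) ^ 2 * u)) ^ p *
        ((1 + t * a) ^ 2 + 2 * (1 + t * a) * (t * b) * u) ^ 2) =
      fun t ↦ (1 + (1 + t * a) ^ 2 * u) ^ (-p) *
        ((1 + t * a) ^ 2 + 2 * (1 + t * a) * (t * b) * u) ^ 2 := by
    funext s
    rw [one_div, Real.inv_rpow (hpos s).le, Real.rpow_neg (hpos s).le]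
  rw [h0]
  have h1 : HasDerivAt (fun t : ℝ ↦ 1 + t * a) a t := by
    simpa using ((hasDerivAt_id t).mul_const a).const_add 1
  have h2 : HasDerivAt (fun t : ℝ ↦ t * b) b t := by
    simpa using (hasDerivAt_id t).mul_const b
  have h3 : HasDerivAt (fun t : ℝ ↦ (1 + t * a) ^ 2) (2 * (1 + t * a) * a) t := by
    simpa using h1.fun_pow 2
  have h4 : HasDerivAt (fun t : ℝ ↦ 1 + (1 + t * a) ^ 2 * u) (2 * (1 + t * a) * a * u) t :=
    (h3.mul_const u).const_add 1
  have h5 : HasDerivAt (fun t : ℝ ↦ (1 + t * a) ^ 2 + 2 * (1 + t * a) * (t * b) * u)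
      (2 * (1 + t * a) * a + 2 * (a * (t * b) + (1 + t * a) * b) * u) t := by
    have h6 := h3.add (((h1.mul h2).const_mul 2).mul_const u)
    refine (h6.congr_of_eventuallyEq (Filter.Eventually.of_forall fun s ↦ ?_))
    simp only [Pi.add_apply, Pi.mul_apply]
    ring
  have h7 := (h4.rpow_const (p := -p) (Or.inl (hpos t).ne')).mul (h5.fun_pow 2)
  exact h7.congr_deriv (by simp)

theorem eq_of_mfderiv_eq_zero {n : ℕ} {M : Type*} [TopologicalSpace M] [PreconnectedSpace M]
    [ChartedSpace (EuclideanSpace ℝ (Fin n)) M] [IsManifold (𝓡 n) ∞ M] {f : M → ℝ}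
    (hf : MDifferentiable (𝓡 n) 𝓘(ℝ, ℝ) f) (hf' : ∀ x, mfderiv (𝓡 n) 𝓘(ℝ, ℝ) f x = 0) (x y : M) :
    f x = f y := by
  have : IsManifold (𝓡 n) 1 M := IsManifold.of_le (n := ∞) (by norm_num)
  refine IsLocallyConstant.apply_eq_of_preconnectedSpace (fun s ↦ ?_) x y
  rw [isOpen_iff_mem_nhds]
  intro z hz
  set e := chartAt (EuclideanSpace ℝ (Fin n)) z
  have he := (mdifferentiable_chart (I := 𝓡 n) z).symm
  have hd (w : EuclideanSpace ℝ (Fin n)) (hw : w ∈ e.target) :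
      HasMFDerivAt (𝓡 n) 𝓘(ℝ, ℝ) (f ∘ e.symm) w 0 := by
    have h := (hf (e.symm w)).hasMFDerivAt.comp w (he.mdifferentiableAt hw).hasMFDerivAt
    rw [hf', ContinuousLinearMap.zero_comp] at h
    exact h
  have hd' (w : EuclideanSpace ℝ (Fin n)) (hw : w ∈ e.target) :
      HasFDerivAt (f ∘ e.symm) (0 : EuclideanSpace ℝ (Fin n) →L[ℝ] ℝ) w :=
    hasMFDerivAt_iff_hasFDerivAt.1 (hd w hw)
  have hopen : IsOpen (e.target ∩ (f ∘ e.symm) ⁻¹' s) :=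
    e.open_target.isOpen_inter_preimage_of_fderiv_eq_zero
      (fun w hw ↦ (hd' w hw).differentiableAt.differentiableWithinAt)
      (fun w hw ↦ (hd' w hw).fderiv) s
  have hopen2 := e.isOpen_inter_preimage hopen
  have hz' : z ∈ e.source := mem_chart_source _ z
  refine Filter.mem_of_superset (hopen2.mem_nhds
    ⟨hz', e.map_source hz', by simpa [e.left_inv hz'] using hz⟩) ?_
  rintro w ⟨hw, hw'⟩
  simpa [e.left_inv hw] using hw'.2

/-! ### Radial variations and metric compatibility -/

section Sections

variable {n : ℕ} {M : Type*} [TopologicalSpace M]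
  [ChartedSpace (EuclideanSpace ℝ (Fin n)) M]
  {F : Type*} [NormedAddCommGroup F] [NormedSpace ℝ F]
  {V : M → Type*} [TopologicalSpace (TotalSpace F V)]
  [∀ x, NormedAddCommGroup (V x)] [FiberBundle F V]

theorem IsSmoothVariation.contMDiff_apply {σ : Π x : M, V x} {s : ℝ → Π x : M, V x}
    (hs : IsSmoothVariation (n := n) (F := F) σ s) (t : ℝ) :
    ContMDiff (𝓡 n) ((𝓡 n).prod 𝓘(ℝ, F)) ∞ (fun x ↦ TotalSpace.mk' F x (s t x)) :=
  hs.smooth.comp (contMDiff_id.prodMk contMDiff_const)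

variable [∀ x, InnerProductSpace ℝ (V x)] [VectorBundle ℝ F V]

/-- Adding `t` times a smooth multiple of a smooth section is a smooth variation. -/
theorem isSmoothVariation_one_add_mul_smul {σ : Π x : M, V x} {a : M → ℝ}
    (hσ : ContMDiff (𝓡 n) ((𝓡 n).prod 𝓘(ℝ, F)) ∞ (fun x ↦ TotalSpace.mk' F x (σ x)))
    (ha : ContMDiff (𝓡 n) 𝓘(ℝ, ℝ) ∞ a) :
    IsSmoothVariation (n := n) (F := F) σ fun t x ↦ (1 + t * a x) • σ x := by
  refine ⟨fun z ↦ ?_, by simp⟩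
  have h1 : ContMDiffAt ((𝓡 n).prod 𝓘(ℝ, ℝ)) ((𝓡 n).prod 𝓘(ℝ, F)) ∞
      (fun z : M × ℝ ↦ TotalSpace.mk' F z.1 (σ z.1)) z := (hσ.comp contMDiff_fst) z
  rw [Bundle.contMDiffAt_totalSpace] at h1 ⊢
  refine ⟨h1.1, ?_⟩
  have h2 : ContMDiffAt ((𝓡 n).prod 𝓘(ℝ, ℝ)) 𝓘(ℝ, ℝ) ∞
      (fun z : M × ℝ ↦ 1 + z.2 * a z.1) z :=
    contMDiffAt_const.add (contMDiffAt_snd.mul ((ha.comp contMDiff_fst) z))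
  refine (h2.smul h1.2).congr_of_eventuallyEq ?_
  set e := trivializationAt F V z.1
  have h3 : ∀ᶠ w : M × ℝ in nhds z, w.1 ∈ e.baseSet :=
    continuousAt_fst.eventually (e.open_baseSet.mem_nhds
      (FiberBundle.mem_baseSet_trivializationAt' z.1))
  filter_upwards [h3] with w hw
  exact (e.linear ℝ hw).map_smul _ _

variable [IsContMDiffRiemannianBundle (𝓡 n) ∞ F V]

theorem contMDiff_norm_sq {σ : Π x : M, V x}
    (hσ : ContMDiff (𝓡 n) ((𝓡 n).prod 𝓘(ℝ, F)) ∞ (fun x ↦ TotalSpace.mk' F x (σ x))) :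
    ContMDiff (𝓡 n) 𝓘(ℝ, ℝ) ∞ fun x ↦ ‖σ x‖ ^ 2 := by
  have h : ContMDiff (𝓡 n) 𝓘(ℝ, ℝ) ∞ fun x ↦ inner ℝ (σ x) (σ x) :=
    fun x ↦ (hσ x).inner_bundle (hσ x)
  simpa only [real_inner_self_eq_norm_sq] using h

variable [FiniteDimensional ℝ F] [ContMDiffVectorBundle ∞ F V (𝓡 n)]

theorem mfderiv_norm_sq {cov : CovariantDerivative (𝓡 n) F V}
    (hcov : cov.IsMetricCompatible) {σ : Π x : M, V x}
    (hσ : ContMDiff (𝓡 n) ((𝓡 n).prod 𝓘(ℝ, F)) ∞ (fun x ↦ TotalSpace.mk' F x (σ x)))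
    (x : M) (X : TangentSpace (𝓡 n) x) :
    mvfderiv (𝓡 n) (fun x ↦ ‖σ x‖ ^ 2) x X = 2 * inner ℝ (cov σ x X) (σ x) := by
  classical
  have hd := (hσ x).mdifferentiableAt (by norm_num)
  -- Only the value of the vector field at `x` matters, so a possibly discontinuous extension of `X`
  -- suffices.
  have h := hcov.mvfderiv_inner_eq (Function.update 0 x X) hd hd
  simp only [Function.update_self, real_inner_self_eq_norm_sq] at h
  rw [real_inner_comm (cov σ x X), ← two_mul] at h
  exact h

/-- Both inner products are half the differentials of squared lengths, so this is the chain rule;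
`∇τ` itself is never computed. -/
theorem inner_cov_comp_smul {cov : CovariantDerivative (𝓡 n) F V}
    (hcov : cov.IsMetricCompatible) {σ τ : Π x : M, V x}
    (hσ : ContMDiff (𝓡 n) ((𝓡 n).prod 𝓘(ℝ, F)) ∞ (fun x ↦ TotalSpace.mk' F x (σ x)))
    (hτ : ContMDiff (𝓡 n) ((𝓡 n).prod 𝓘(ℝ, F)) ∞ (fun x ↦ TotalSpace.mk' F x (τ x)))
    {g : ℝ → ℝ} {g' : ℝ} {x : M} (hg : HasDerivAt g g' (‖σ x‖ ^ 2))
    (hστ : ∀ x, ‖τ x‖ ^ 2 = g (‖σ x‖ ^ 2)) (X : TangentSpace (𝓡 n) x) :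
    inner ℝ (cov τ x X) (τ x) = g' * inner ℝ (cov σ x X) (σ x) := by
  have h1 := mfderiv_norm_sq hcov hτ x X
  have h2 := mfderiv_norm_sq hcov hσ x X
  have h3 := hg.hasFDerivAt.hasMFDerivAt.comp x
    (((contMDiff_norm_sq hσ) x).mdifferentiableAt (by norm_num)).hasMFDerivAt
  have h5 : (g ∘ fun x ↦ ‖σ x‖ ^ 2) = fun x ↦ ‖τ x‖ ^ 2 := (funext hστ).symm
  rw [h5] at h3
  rw [mvfderiv, h3.mfderiv] at h1
  have h4 : mvfderiv (𝓡 n) (fun x ↦ ‖σ x‖ ^ 2) x X * g' =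
      2 * inner ℝ (cov τ x X) (τ x) := h1
  rw [h2] at h4
  linarith

end Sections

/-! ### The radial energy and its stationary sections -/

section Uniqueness

variable {n : ℕ} {M : Type*} [TopologicalSpace M] [ChartedSpace (EuclideanSpace ℝ (Fin n)) M]
  [RiemannianBundle (fun x : M ↦ TangentSpace (𝓡 n) x)]
  {F : Type*} [NormedAddCommGroup F] [NormedSpace ℝ F]
  {V : M → Type*} [TopologicalSpace (TotalSpace F V)]
  [∀ x, NormedAddCommGroup (V x)] [∀ x, InnerProductSpace ℝ (V x)] [FiberBundle F V]

/-- The squared length of the one-form `X ↦ ⟨∇_X σ, σ⟩`, which is half the differential of `|σ|²`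
if the connection is metric. -/
noncomputable def radialNormSq (cov : CovariantDerivative (𝓡 n) F V) (σ : Π x : M, V x) (x : M) :
    ℝ :=
  ∑ i, inner ℝ (cov σ x (stdOrthonormalBasis ℝ (TangentSpace (𝓡 n) x) i)) (σ x) ^ 2

theorem verticalNormSq_eq_add (cov : CovariantDerivative (𝓡 n) F V) (p q : ℝ) (σ : Π x : M, V x)
    (x : M) : verticalNormSq cov p q σ x = verticalNormSq cov p 0 σ x +
      q * ((1 / (1 + ‖σ x‖ ^ 2)) ^ p * radialNormSq cov σ x) := by
  simp only [verticalNormSq, radialNormSq, verticalForm, Finset.mul_sum, ← Finset.sum_add_distrib]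
  exact Finset.sum_congr rfl fun i _ ↦ by ring

theorem radialNormSq_nonneg (cov : CovariantDerivative (𝓡 n) F V) (σ : Π x : M, V x) (x : M) :
    0 ≤ radialNormSq cov σ x :=
  Finset.sum_nonneg fun _ _ ↦ sq_nonneg _

theorem inner_cov_eq_zero_of_radialNormSq_eq_zero {cov : CovariantDerivative (𝓡 n) F V}
    {σ : Π x : M, V x} {x : M} (h : radialNormSq cov σ x = 0) (X : TangentSpace (𝓡 n) x) :
    inner ℝ (cov σ x X) (σ x) = 0 := by
  have h1 := (Finset.sum_eq_zero_iff_of_nonneg fun _ _ ↦ sq_nonneg _).1 h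
  have h2 : (innerSL ℝ (σ x)).toLinearMap ∘ₗ (cov σ x).toLinearMap = 0 := by
    refine (stdOrthonormalBasis ℝ (TangentSpace (𝓡 n) x)).toBasis.ext fun i ↦ ?_
    simpa [real_inner_comm] using h1 i (Finset.mem_univ i)
  rw [real_inner_comm]
  exact LinearMap.congr_fun h2 X

variable [IsManifold (𝓡 n) ∞ M] [IsContMDiffRiemannianBundle (𝓡 n) ∞ (EuclideanSpace ℝ (Fin n))
    (fun x : M ↦ TangentSpace (𝓡 n) x)]
  [VectorBundle ℝ F V] [IsContMDiffRiemannianBundle (𝓡 n) ∞ F V]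

/-- At `p = 0` the weight is `1`, and the radial term is the difference of the vertical densities
for `q = 1` and `q = 0`. -/
theorem continuous_radialNormSq (cov : CovariantDerivative (𝓡 n) F V)
    [cov.ContMDiffCovariantDerivative ∞] {σ : Π x : M, V x}
    (hσ : ContMDiff (𝓡 n) ((𝓡 n).prod 𝓘(ℝ, F)) ∞ (fun x ↦ TotalSpace.mk' F x (σ x))) :
    Continuous (radialNormSq cov σ) := by
  have h : radialNormSq cov σ = fun x ↦
      verticalNormSq cov 0 1 σ x - verticalNormSq cov 0 0 σ x := by
    funext x
    rw [verticalNormSq_eq_add cov 0 1]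
    simp
  rw [h]
  exact (continuous_verticalNormSq cov 0 1 hσ).sub (continuous_verticalNormSq cov 0 0 hσ)

variable [T2Space M] [CompactSpace M] [MeasurableSpace M] [BorelSpace M]

theorem verticalEnergy_sub (cov : CovariantDerivative (𝓡 n) F V)
    [cov.ContMDiffCovariantDerivative ∞] (p q q' : ℝ) {σ : Π x : M, V x}
    (hσ : ContMDiff (𝓡 n) ((𝓡 n).prod 𝓘(ℝ, F)) ∞ (fun x ↦ TotalSpace.mk' F x (σ x))) :
    verticalEnergy cov p q σ - verticalEnergy cov p q' σ = (q - q') / 2 *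
      ∫ x, (1 / (1 + ‖σ x‖ ^ 2)) ^ p * radialNormSq cov σ x ∂(riemannianVolume n M) := by
  have := isFiniteMeasure_riemannianVolume n M
  have hint (r : ℝ) : Integrable (verticalNormSq cov p r σ) (riemannianVolume n M) :=
    (continuous_verticalNormSq cov p r hσ).integrable_of_hasCompactSupport
      (HasCompactSupport.of_compactSpace _)
  rw [verticalEnergy, verticalEnergy, ← mul_sub, ← integral_sub (hint q) (hint q'),
    ← integral_const_mul, ← integral_const_mul]
  refine integral_congr_ae (Filter.Eventually.of_forall fun x ↦ ?_)
  simp only [verticalNormSq_eq_add cov p q, verticalNormSq_eq_add cov p q']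
  ring

/-- A section which is stationary for `½ ∫ (1 + |σ|²)⁻ᵖ |⟨∇σ, σ⟩|² vol(g)` has `⟨∇σ, σ⟩ = 0`. -/
theorem radialNormSq_eq_zero_of_hasDerivAt [FiniteDimensional ℝ F]
    [ContMDiffVectorBundle ∞ F V (𝓡 n)] {cov : CovariantDerivative (𝓡 n) F V}
    [cov.ContMDiffCovariantDerivative ∞]
    (hcov : cov.IsMetricCompatible) {p : ℝ} {σ : Π x : M, V x}
    (hσ : ContMDiff (𝓡 n) ((𝓡 n).prod 𝓘(ℝ, F)) ∞ (fun x ↦ TotalSpace.mk' F x (σ x)))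
    (hstat : ∀ s : ℝ → Π x : M, V x, IsSmoothVariation (n := n) (F := F) σ s →
      HasDerivAt (fun t ↦ ∫ x, (1 / (1 + ‖s t x‖ ^ 2)) ^ p * radialNormSq cov (s t) x
        ∂(riemannianVolume n M)) 0 0) (x : M) :
    radialNormSq cov σ x = 0 := by
  have := isFiniteMeasure_riemannianVolume n M
  have := isOpenPosMeasure_riemannianVolume n M
  have hu := contMDiff_norm_sq hσ
  have huc := hu.continuous
  have hpos (x : M) : 0 < 1 + ‖σ x‖ ^ 2 := by positivity
  -- As a function of `u = |σ|²`, `a` solves `(1 + u) a' = (p/2) a`, and `b` is `a'`. This cancels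
  -- the terms of indefinite sign in the first variation.
  set a : M → ℝ := fun x ↦ (1 + ‖σ x‖ ^ 2) ^ (p / 2) with ha_def
  set b : M → ℝ := fun x ↦ p / 2 * (1 + ‖σ x‖ ^ 2) ^ (p / 2 - 1) with hb_def
  have ha : ContMDiff (𝓡 n) 𝓘(ℝ, ℝ) ∞ a := fun x ↦
    ((Real.contDiffAt_rpow_const_of_ne (n := ∞) (p := p / 2) (hpos x).ne').contMDiffAt).comp x
      ((contMDiff_const.add hu) x)
  have hac : Continuous a := ha.continuous
  have hbc : Continuous b := continuous_const.mul
    ((continuous_const.add huc).rpow_const fun x ↦ Or.inl (hpos x).ne')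
  have hD := continuous_radialNormSq cov hσ
  have hvar := isSmoothVariation_one_add_mul_smul hσ ha
  set s : ℝ → Π x : M, V x := fun t x ↦ (1 + t * a x) • σ x with hs_def
  have hnorm (t : ℝ) (x : M) : ‖s t x‖ ^ 2 = (1 + t * a x) ^ 2 * ‖σ x‖ ^ 2 := by
    simp only [hs_def, norm_smul, mul_pow, Real.norm_eq_abs, sq_abs]
  have hrad (t : ℝ) (x : M) : radialNormSq cov (s t) x =
      ((1 + t * a x) ^ 2 + 2 * (1 + t * a x) * (t * b x) * ‖σ x‖ ^ 2) ^ 2 *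
        radialNormSq cov σ x := by
    have hg : HasDerivAt (fun v : ℝ ↦ (1 + t * (1 + v) ^ (p / 2)) ^ 2 * v)
        ((1 + t * a x) ^ 2 + 2 * (1 + t * a x) * (t * b x) * ‖σ x‖ ^ 2) (‖σ x‖ ^ 2) := by
      have h1 := ((hasDerivAt_id (‖σ x‖ ^ 2)).const_add 1).rpow_const (p := p / 2)
        (Or.inl (hpos x).ne')
      have h2 := (((h1.const_mul t).const_add 1).fun_pow 2).mul (hasDerivAt_id (‖σ x‖ ^ 2))
      refine h2.congr_deriv ?_
      simp [ha_def, hb_def]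
      ring
    simp only [radialNormSq, Finset.mul_sum]
    refine Finset.sum_congr rfl fun i _ ↦ ?_
    rw [inner_cov_comp_smul hcov hσ (hvar.contMDiff_apply t) hg (hnorm t), mul_pow]
  have hderiv (t : ℝ) (x : M) := (hasDerivAt_rpow_mul_sq (p := p) (a := a x) (b := b x)
    (sq_nonneg ‖σ x‖) t).mul_const (radialNormSq cov σ x)
  have hbase (t : ℝ) (x : M) : 0 < 1 + (1 + t * a x) ^ 2 * ‖σ x‖ ^ 2 := by positivity
  have hint := hasDerivAt_integral_of_continuous_deriv (riemannianVolume n M)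
    (fun t ↦ ?_) ?_ hderiv 0
  rotate_left
  · have h1 : Continuous fun x ↦ (1 / (1 + (1 + t * a x) ^ 2 * ‖σ x‖ ^ 2)) ^ p :=
      Continuous.rpow_const
        (continuous_const.div (by fun_prop) fun x ↦ (hbase t x).ne')
        fun x ↦ Or.inl (one_div_pos.2 (hbase t x)).ne'
    fun_prop
  -- Only continuity of the squared length as a real function is used, so it is made opaque.
  · obtain ⟨u, hu_eq⟩ : ∃ u : M → ℝ, ∀ x, ‖σ x‖ ^ 2 = u x := ⟨_, fun _ ↦ rfl⟩
    simp only [hu_eq] at huc hbase ⊢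
    have h1 (r : ℝ) : Continuous fun z : ℝ × M ↦
        (1 + (1 + z.1 * a z.2) ^ 2 * u z.2) ^ r :=
      Continuous.rpow_const (by fun_prop) fun z ↦ Or.inl (hbase z.1 z.2).ne'
    have h2 := h1 (-p - 1)
    have h3 := h1 (-p)
    fun_prop
  have hstat' := hstat s hvar
  simp only [hnorm, hrad] at hstat'
  have hzero := hstat'.unique (hint.congr_of_eventuallyEq (Filter.Eventually.of_forall fun t ↦
    integral_congr_ae (Filter.Eventually.of_forall fun x ↦ (mul_assoc _ _ _).symm)))
  have hzero' : ∫ x, 4 * (1 + ‖σ x‖ ^ 2) ^ (-p) * a x * radialNormSq cov σ x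
      ∂(riemannianVolume n M) = 0 := by
    rw [hzero]
    refine integral_congr_ae (Filter.Eventually.of_forall fun x ↦ ?_)
    -- The differential equation for `a`, which removes everything but the positive term.
    have h1 : (1 + ‖σ x‖ ^ 2) * b x = p / 2 * a x := by
      simp only [ha_def, hb_def, Real.rpow_sub_one (hpos x).ne']
      field_simp
    have h2 : (1 + ‖σ x‖ ^ 2) ^ (-p) = (1 + ‖σ x‖ ^ 2) ^ (-p - 1) * (1 + ‖σ x‖ ^ 2) := by
      rw [Real.rpow_sub_one (hpos x).ne', div_mul_cancel₀ _ (hpos x).ne']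
    simp only [zero_mul, add_zero, one_pow, one_mul, mul_one, mul_zero, zero_add]
    rw [h2]
    linear_combination (-4 * (1 + ‖σ x‖ ^ 2) ^ (-p - 1) * ‖σ x‖ ^ 2 * radialNormSq cov σ x) * h1
  have hcont : Continuous fun x ↦
      4 * (1 + ‖σ x‖ ^ 2) ^ (-p) * a x * radialNormSq cov σ x := by
    have h1 : Continuous fun x ↦ (1 + ‖σ x‖ ^ 2) ^ (-p) :=
      (continuous_const.add huc).rpow_const fun x ↦ Or.inl (hpos x).ne'
    fun_prop
  have hapos (x : M) : 0 < 4 * (1 + ‖σ x‖ ^ 2) ^ (-p) * a x :=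
    mul_pos (mul_pos four_pos (Real.rpow_pos_of_pos (hpos x) _)) (Real.rpow_pos_of_pos (hpos x) _)
  have hae := (integral_eq_zero_iff_of_nonneg
    (fun x ↦ mul_nonneg (hapos x).le (radialNormSq_nonneg cov σ x))
    (hcont.integrable_of_hasCompactSupport (HasCompactSupport.of_compactSpace _))).1 hzero'
  -- Continuity and positivity of the measure on open sets upgrade almost everywhere to everywhere.
  have heq := (hcont.ae_eq_iff_eq _ continuous_const).1 hae
  exact (mul_eq_zero.1 (congrFun heq x)).resolve_left (hapos x).ne'

end Uniqueness

/-! ### Uniqueness of `q` -/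

theorem theorem4p8 {n : ℕ}
    {M : Type*} [TopologicalSpace M] [T2Space M] [CompactSpace M] [ConnectedSpace M]
    [MeasurableSpace M] [BorelSpace M]
    [ChartedSpace (EuclideanSpace ℝ (Fin n)) M] [IsManifold (𝓡 n) ∞ M]
    [RiemannianBundle (fun x : M ↦ TangentSpace (𝓡 n) x)]
    [IsContMDiffRiemannianBundle (𝓡 n) ∞ (EuclideanSpace ℝ (Fin n))
      (fun x : M ↦ TangentSpace (𝓡 n) x)]
    {F : Type*} [NormedAddCommGroup F] [NormedSpace ℝ F] [FiniteDimensional ℝ F]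
    {V : M → Type*} [TopologicalSpace (TotalSpace F V)]
    [∀ x, NormedAddCommGroup (V x)] [∀ x, InnerProductSpace ℝ (V x)]
    [FiberBundle F V] [VectorBundle ℝ F V] [ContMDiffVectorBundle ∞ F V (𝓡 n)]
    [IsContMDiffRiemannianBundle (𝓡 n) ∞ F V]
    (cov : CovariantDerivative (𝓡 n) F V) [cov.ContMDiffCovariantDerivative ∞]
    (hcov : cov.IsMetricCompatible)
    (σ : Π x : M, V x)
    (hσ : ContMDiff (𝓡 n) ((𝓡 n).prod 𝓘(ℝ, F)) ∞ (fun x ↦ TotalSpace.mk' F x (σ x)))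
    (hlength : ¬ ∃ k : ℝ, ∀ x, ‖σ x‖ = k)
    (p : ℝ) :
    {q : ℝ | IsPQHarmonic cov p q σ}.Subsingleton := by
  rintro q ⟨-, hq⟩ q' ⟨-, hq'⟩
  by_contra hne
  have hne' : (q - q') / 2 ≠ 0 := div_ne_zero (sub_ne_zero.2 hne) two_ne_zero
  have hzero := radialNormSq_eq_zero_of_hasDerivAt hcov (p := p) hσ fun s hs ↦ by
    -- Dividing the difference of the two energies by `(q - q') / 2` leaves the radial integral.
    have h := ((hq s hs).sub (hq' s hs)).const_mul ((q - q') / 2)⁻¹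
    simp only [sub_zero, mul_zero] at h
    refine h.congr_of_eventuallyEq (Filter.Eventually.of_forall fun t ↦ ?_)
    simp only [Pi.sub_apply, verticalEnergy_sub cov p q q' (hs.contMDiff_apply t)]
    rw [inv_mul_cancel_left₀ hne']
  have hd (x : M) : mfderiv (𝓡 n) 𝓘(ℝ, ℝ) (fun x ↦ ‖σ x‖ ^ 2) x = 0 := by
    ext X
    have h := mfderiv_norm_sq hcov hσ x X
    rw [inner_cov_eq_zero_of_radialNormSq_eq_zero (hzero x), mul_zero] at h
    exact h
  obtain ⟨x₀⟩ := (inferInstance : Nonempty M)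
  refine hlength ⟨‖σ x₀‖, fun x ↦ ?_⟩
  have h := eq_of_mfderiv_eq_zero ((contMDiff_norm_sq hσ).mdifferentiable (by norm_num)) hd x x₀
  exact (sq_eq_sq₀ (norm_nonneg _) (norm_nonneg _)).1 h
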